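/- Let $n\ge r\ge 1$ be integers and write $n=q_1r+r_1$ with $0\le r_1<r$. Let $\mu_{n,r}:\mathbb C^n\times\mathbb C^r\to\mathbb C^{n+r}$ be the map sending the coefficients $(a_0,\dots,a_{n-1},b_0,\dots,b_{r-1})$ of the monic polynomials $f(x)=x^n+a_{n-1}x^{n-1}+\cdots+a_0$ and $g(x)=x^r+b_{r-1}x^{r-1}+\cdots+b_0$ to the coefficients $(c_{n+r-1},\dots,c_0)$ of $f(x)g(x)=x^{n+r}+c_{n+r-1}x^{n+r-1}+\cdots+c_0$. Let $\mathcal A$ be the algebra of germs at the origin of holomorphic functions on $\mathbb C^n\times\mathbb C^r$, let $m=n+r$, and let $I(\mu_{n,r})\subset\mathcal A$ be the ideal generated by the germs of $c_{n+r-1},\dots,c_0$. For a proper ideal $J\subset\mathcal A$, let $\delta J$ be its Jacobian matrix, with rows the partial derivatives $(\partial f/\partial x_1,\dots,\partial f/\partial x_m)$ of the functions $f\in J$ with respect to the $m$ coordinates. For $k\ge 0$ let $\Delta_kJ$ be the ideal generated by $J$ and all $k\times k$ minors of $\delta J$ (so $\Delta_0J=\mathcal A$ and $\Delta_{m+1}J=J$),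 and put $\Delta^iJ=\Delta_{m-i+1}J$. The critical extension of $J$ is $\Delta_kJ$ for the least $k$ with $\Delta_kJ\neq\mathcal A$; it equals $\Delta^iJ$ with $i=m-k+1$. Set $J_0=I(\mu_{n,r})$ and, for $s\ge 1$, let $J_s=\Delta^{i_s}J_{s-1}$ be the critical extension of $J_{s-1}$. The Thom–Boardman symbol $TB(I(\mu_{n,r}))$ is the infinite sequence $(i_1,i_2,i_3,\dots)$ (trailing zeros are usually omitted). Then the $(q_1+1)$-th entry of $TB(I(\mu_{n,r}))$ is $i_{q_1+1}=r_1$. Moreover, the Jacobian matrix $\delta J_{q_1}$ of the $q_1$-th successive critical extension $J_{q_1}$ of $I(\mu_{n,r})$ has rank $n+r-r_1$ when evaluated at the origin. -/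

import Mathlib

open Filter Topology

noncomputable section

namespace ThomBoardman

section Germs

variable (ι : Type) [Fintype ι]

/-- The algebra of germs at the origin of `ℂ^ι` of holomorphic functions. (A function which is
`C^∞` over `ℂ` near a point is the same thing as a function analytic at that point.) -/
def HolGerm : Subring (Germ (𝓝 (0 : ι → ℂ)) ℂ) where
  carrier := {φ | ∃ f : (ι → ℂ) → ℂ, AnalyticAt ℂ f 0 ∧ (f : Germ (𝓝 (0 : ι → ℂ)) ℂ) = φ}
  mul_mem' := by
    rintro _ _ ⟨f, hf, rfl⟩ ⟨g, hg, rfl⟩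
    exact ⟨f * g, hf.mul hg, rfl⟩
  one_mem' := ⟨fun _ => 1, analyticAt_const, rfl⟩
  add_mem' := by
    rintro _ _ ⟨f, hf, rfl⟩ ⟨g, hg, rfl⟩
    exact ⟨f + g, hf.add hg, rfl⟩
  zero_mem' := ⟨fun _ => 0, analyticAt_const, rfl⟩
  neg_mem' := by
    rintro _ ⟨f, hf, rfl⟩
    exact ⟨-f, hf.neg, rfl⟩

variable {ι}

/-- The germ at the origin of a function that is analytic there. -/
def HolGerm.mk (f : (ι → ℂ) → ℂ) (hf : AnalyticAt ℂ f 0) : HolGerm ι :=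
  ⟨(f : Germ (𝓝 (0 : ι → ℂ)) ℂ), f, hf, rfl⟩

/-- The value of a germ at the origin. -/
def evalZero (φ : HolGerm ι) : ℂ := φ.1.value

/-- The partial derivative `∂φ/∂x_i` of a germ: the germ of
`x ↦ (d/dt) f (x + t e_i)` at `t = 0`, for any representative `f` of `φ`. -/
def partialDeriv [DecidableEq ι] (i : ι) (φ : HolGerm ι) : HolGerm ι :=
  ⟨Germ.map' (fun (f : (ι → ℂ) → ℂ) (x : ι → ℂ) => fderiv ℂ f x (Pi.single i 1))
    (fun f g (h : f =ᶠ[𝓝 0] g) => show _ =ᶠ[𝓝 0] _ by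
      filter_upwards [h.fderiv (𝕜 := ℂ)] with x hx using by rw [hx]) φ.1, by
    obtain ⟨_, f, hf, rfl⟩ := φ
    exact ⟨fun x => fderiv ℂ f x (Pi.single i 1),
      (ContinuousLinearMap.apply ℂ ℂ (Pi.single i (1 : ℂ) : ι → ℂ)).analyticAt _ |>.comp hf.fderiv,
      rfl⟩⟩

/-- The Jacobian matrix `δJ` of an ideal of germs: its rows are indexed by all the
functions `f` in `J`, its columns by the coordinates, and its entries are `∂f/∂x_i`. -/
def jacobian [DecidableEq ι] (J : Ideal (HolGerm ι)) : Matrix J ι (HolGerm ι) :=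
  Matrix.of fun f i => partialDeriv i f.1

/-- The rank of `δJ` evaluated at the origin. -/
def jacobianRankAtZero [DecidableEq ι] (J : Ideal (HolGerm ι)) : ℕ :=
  ((jacobian J).map evalZero).rank

/-- The Jacobian extension `Δ_k J`: the ideal spanned by `J` and all minors of order `k` of
the Jacobian matrix of `J`. (The empty minor is `1`, so `Δ_0 J` is the whole algebra, and
`Δ_k J = J` when `k` exceeds the number of coordinates.) -/
def jacobianExt [DecidableEq ι] (k : ℕ) (J : Ideal (HolGerm ι)) : Ideal (HolGerm ι) :=
  J ⊔ Ideal.span {d | ∃ (rows : Fin k → J) (cols : Fin k → ι),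
    d = ((jacobian J).submatrix rows cols).det}

/-- The order of the critical Jacobian extension of a proper ideal: the least order `k` of minors
for which `Δ_k J` is not the whole algebra. -/
def criticalOrder [DecidableEq ι] (J : Ideal (HolGerm ι)) : ℕ :=
  sInf {k | jacobianExt k J ≠ ⊤}

/-- The critical extension of `J`. -/
def criticalExt [DecidableEq ι] (J : Ideal (HolGerm ι)) : Ideal (HolGerm ι) :=
  jacobianExt (criticalOrder J) J

/-- The upper index `i` of the critical extension `Δ^i J = Δ_{m-i+1} J`, where `m` is the number of
coordinates. -/
def criticalIndex [DecidableEq ι] (J : Ideal (HolGerm ι)) : ℕ :=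
  Fintype.card ι + 1 - criticalOrder J

/-- The Thom-Boardman symbol of `J` as an infinite sequence: the entry with (zero-based) number
`s` is the upper index of the critical extension of the `s`-fold critical extension of `J`. -/
def TB [DecidableEq ι] (J : Ideal (HolGerm ι)) (s : ℕ) : ℕ :=
  criticalIndex (criticalExt^[s] J)

end Germs

section Multiplication

open Polynomial

/-- The monic polynomial `x^n + a_{n-1} x^{n-1} + ⋯ + a_0`. -/
def monicPoly {n : ℕ} (a : Fin n → ℂ) : ℂ[X] := X ^ n + ∑ i : Fin n, C (a i) * X ^ (i : ℕ)

/-- The multiplication map `μ_{n,r} : ℂ^n × ℂ^r → ℂ^{n+r}`, sending the lower coefficients of two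
monic polynomials of degrees `n` and `r` to those of their product. A point of `ℂ^n × ℂ^r` is
given by its coordinates `a_i = p (Sum.inl i)` and `b_j = p (Sum.inr j)`. -/
def mulMap (n r : ℕ) (p : Fin n ⊕ Fin r → ℂ) : Fin (n + r) → ℂ := fun j =>
  (monicPoly (fun i => p (Sum.inl i)) * monicPoly (fun i => p (Sum.inr i))).coeff j

theorem analyticAt_mulMap (n r : ℕ) (j : Fin (n + r)) :
    AnalyticAt ℂ (fun p => mulMap n r p j) 0 := by
  have key : ∀ (m : ℕ) (e : Fin m → Fin n ⊕ Fin r) (k : ℕ),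
      AnalyticAt ℂ (fun p : Fin n ⊕ Fin r → ℂ => (monicPoly (fun i => p (e i))).coeff k) 0 := by
    intro m e k
    simp only [monicPoly, coeff_add, finsetSum_coeff, coeff_C_mul]
    refine analyticAt_const.add (Finset.analyticAt_fun_sum _ fun i _ => ?_)
    exact ((ContinuousLinearMap.proj (R := ℂ) (φ := fun _ : Fin n ⊕ Fin r => ℂ)
      (e i)).analyticAt 0).mul analyticAt_const
  simp only [mulMap, coeff_mul]
  exact Finset.analyticAt_fun_sum _ fun x _ => (key n Sum.inl x.1).mul (key r Sum.inr x.2)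

/-- The ideal `I(μ_{n,r})` generated by the germs at the origin of the components `c_j` of the
multiplication map. -/
def mulIdeal (n r : ℕ) : Ideal (HolGerm (Fin n ⊕ Fin r)) :=
  Ideal.span (Set.range fun j : Fin (n + r) =>
    HolGerm.mk (fun p => mulMap n r p j) (analyticAt_mulMap n r j))

end Multiplication

end ThomBoardman

end

/-!
Write `q_s` and `d_s` for the iterated quotients and remainders of `f` by `g`, so that
`f = q_0` and `q_s = d_s + g q_{s+1}`. As long as `s r ≤ n`, the germs of the coefficients of `g`,
`q_s` and `d_0, …, d_{s-1}` are local coordinates, and `J_s` is generated by the coefficients of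
`d_0, …, d_{s-1}` and the lower coefficients of `g^{s+1} q_s`.

A vector field acting on coefficients sends `g^{s+1} q_s` to
`g^s ((s+1) ∂g q_s + g ∂q_s)`. At the origin, where `q_s = x^{n-sr}` and `g = x^r`, the second
factor is an arbitrary polynomial of degree less than `r + (n - s r)` divisible by
`x^{min(r, n-sr)}`, which leaves exactly `min(r, n-sr)` directions tangent to `J_s`: this is the
corank of `δJ_s`, hence the index `i_{s+1}`. These directions are spanned by vector fields which fix
the `d_i` and for which the second factor is `x^b q_s` reduced modulo `g`. When `r ≤ n - s r`, this
is `x^b d_s` modulo `g`, so differentiating `J_s` along them adjoins precisely the coefficients of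
`d_s`, and the result is `J_{s+1}`.
-/

noncomputable section

namespace ThomBoardman

section Germs

variable {ι : Type} [Fintype ι]

/-- Evaluation of germs at the origin, `evalZero`, as a ring homomorphism. Its kernel is the
maximal ideal of the algebra of germs. -/
def evalHom (ι : Type) [Fintype ι] : HolGerm ι →+* ℂ :=
  Germ.valueRingHom.comp (HolGerm ι).subtype

theorem coe_evalHom : ⇑(evalHom ι) = evalZero := rfl

instance : Nontrivial (HolGerm ι) := (evalHom ι).domain_nontrivial

theorem HolGerm.exists_eq_mk (φ : HolGerm ι) : ∃ f hf, φ = HolGerm.mk f hf := by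
  obtain ⟨_, f, hf, rfl⟩ := φ
  exact ⟨f, hf, rfl⟩

theorem isUnit_of_evalHom_ne_zero {φ : HolGerm ι} (h : evalHom ι φ ≠ 0) : IsUnit φ := by
  obtain ⟨f, hf, rfl⟩ := HolGerm.exists_eq_mk φ
  have hf0 : f 0 ≠ 0 := h
  refine IsUnit.of_mul_eq_one (HolGerm.mk f⁻¹ (hf.inv hf0)) (Subtype.ext (Germ.coe_eq.2 ?_))
  filter_upwards [hf.continuousAt.eventually_ne hf0] with x hx
  exact mul_inv_cancel₀ hx

theorem isUnit_natCast_succ (s : ℕ) : IsUnit ((s + 1 : ℕ) : HolGerm ι) := by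
  apply isUnit_of_evalHom_ne_zero
  rw [map_natCast]
  exact Nat.cast_ne_zero.2 s.succ_ne_zero

theorem isUnit_det_of_det_map_evalHom_ne_zero {ν : Type*} [Fintype ν] [DecidableEq ν]
    {M : Matrix ν ν (HolGerm ι)} (h : (M.map (evalHom ι)).det ≠ 0) : IsUnit M.det := by
  apply isUnit_of_evalHom_ne_zero
  rwa [RingHom.map_det]

/-- The germ of a coordinate function. -/
def coordGerm (i : ι) : HolGerm ι :=
  HolGerm.mk (fun p => p i)
    ((ContinuousLinearMap.proj (R := ℂ) (φ := fun _ : ι => ℂ) i).analyticAt 0)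

variable [DecidableEq ι]

theorem partialDeriv_add (i : ι) (φ ψ : HolGerm ι) :
    partialDeriv i (φ + ψ) = partialDeriv i φ + partialDeriv i ψ := by
  obtain ⟨f, hf, rfl⟩ := HolGerm.exists_eq_mk φ
  obtain ⟨g, hg, rfl⟩ := HolGerm.exists_eq_mk ψ
  refine Subtype.ext (Germ.coe_eq.2 ?_)
  filter_upwards [hf.eventually_analyticAt, hg.eventually_analyticAt] with x hfx hgx
  exact congrArg (· (Pi.single i 1)) (fderiv_add hfx.differentiableAt hgx.differentiableAt)

theorem partialDeriv_mul (i : ι) (φ ψ : HolGerm ι) :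
    partialDeriv i (φ * ψ) = φ * partialDeriv i ψ + ψ * partialDeriv i φ := by
  obtain ⟨f, hf, rfl⟩ := HolGerm.exists_eq_mk φ
  obtain ⟨g, hg, rfl⟩ := HolGerm.exists_eq_mk ψ
  refine Subtype.ext (Germ.coe_eq.2 ?_)
  filter_upwards [hf.eventually_analyticAt, hg.eventually_analyticAt] with x hfx hgx
  exact congrArg (· (Pi.single i 1)) (fderiv_mul hfx.differentiableAt hgx.differentiableAt)

theorem partialDeriv_coordGerm (i j : ι) :
    partialDeriv i (coordGerm j) = if j = i then 1 else 0 := by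
  have h (x : ι → ℂ) : fderiv ℂ (fun p : ι → ℂ => p j) x (Pi.single i 1) =
      if j = i then 1 else 0 := by
    rw [(hasFDerivAt_apply j x).fderiv, ContinuousLinearMap.proj_apply, Pi.single_apply]
  refine Subtype.ext ((Germ.coe_eq.2 (Eventually.of_forall h)).trans ?_)
  split_ifs <;> rfl

/-- The partial derivative `∂/∂x_i` as a derivation of the algebra of germs. -/
def partialDerivation (i : ι) : Derivation ℤ (HolGerm ι) (HolGerm ι) :=
  Derivation.mk' (AddMonoidHom.mk' (partialDeriv i) (partialDeriv_add i)).toIntLinearMap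
    (partialDeriv_mul i)

/-- The vector field `∑ i, c i ∂/∂x_i` as a derivation of the algebra of germs. -/
def vectorField (c : ι → HolGerm ι) : Derivation ℤ (HolGerm ι) (HolGerm ι) :=
  ∑ i, c i • partialDerivation i

theorem vectorField_apply (c : ι → HolGerm ι) (φ : HolGerm ι) :
    vectorField c φ = ∑ i, c i * partialDeriv i φ := by
  let ev : Derivation ℤ (HolGerm ι) (HolGerm ι) →+ HolGerm ι :=
    AddMonoidHom.mk' (· φ) fun _ _ => rfl
  exact map_sum ev _ _

theorem vectorField_coordGerm (c : ι → HolGerm ι) (j : ι) :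
    vectorField c (coordGerm j) = c j := by
  simp [vectorField_apply, partialDeriv_coordGerm]

theorem jacobian_mul_transpose {κ : Type*} (J : Ideal (HolGerm ι)) (φ : Matrix κ ι (HolGerm ι)) :
    jacobian J * φ.transpose = Matrix.of fun (g : J) k => vectorField (φ k) g.1 := by
  ext1 g k
  simp [Matrix.mul_apply, vectorField_apply, jacobian, mul_comm]

end Germs

section Minors

open Matrix

variable {R ν κ : Type*} [CommRing R] [Fintype ν] [DecidableEq ν] [Fintype κ]

theorem det_mul_eq_sum_prod_mul_det_submatrix (M : Matrix ν κ R) (N : Matrix κ ν R) :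
    (M * N).det = ∑ p : ν → κ, (∏ j, N (p j) j) * (M.submatrix id p).det := by
  classical
  simp only [det_apply', Matrix.mul_apply, Finset.prod_univ_sum, Fintype.piFinset_univ,
    Finset.mul_sum, submatrix_apply, id_eq, Finset.prod_mul_distrib]
  rw [Finset.sum_comm]
  exact Finset.sum_congr rfl fun p _ => Finset.sum_congr rfl fun σ _ => by ring

theorem det_mul_mem_of_forall_det_submatrix_mem {I : Ideal R} {M : Matrix ν κ R}
    (h : ∀ p : ν → κ, (M.submatrix id p).det ∈ I) (N : Matrix κ ν R) : (M * N).det ∈ I := by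
  rw [det_mul_eq_sum_prod_mul_det_submatrix]
  exact I.sum_mem fun p _ => I.mul_mem_left _ (h p)

theorem det_mul_eq_zero_of_card_lt (h : Fintype.card κ < Fintype.card ν) (M : Matrix ν κ R)
    (N : Matrix κ ν R) : (M * N).det = 0 := by
  refine (Submodule.mem_bot R).1 (det_mul_mem_of_forall_det_submatrix_mem (I := ⊥) (fun p => ?_) N)
  obtain ⟨i, j, hij, hp⟩ := Fintype.exists_ne_map_eq_of_card_lt p h
  exact det_zero_of_column_eq hij fun k => by rw [submatrix_apply, submatrix_apply, hp]

end Minors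

section JacobianExtension

open Matrix

variable {ι : Type} [Fintype ι] [DecidableEq ι] {J : Ideal (HolGerm ι)}

theorem jacobianExt_antitone (J : Ideal (HolGerm ι)) : Antitone fun k => jacobianExt k J := by
  refine antitone_nat_of_succ_le fun k => sup_le le_sup_left (Ideal.span_le.2 ?_)
  rintro _ ⟨rows, cols, rfl⟩
  rw [SetLike.mem_coe, det_succ_row_zero]
  refine Ideal.sum_mem _ fun j _ => Ideal.mul_mem_left _ _ (Ideal.mem_sup_right ?_)
  exact Ideal.subset_span ⟨fun i => rows i.succ, fun i => cols (j.succAbove i), rfl⟩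

theorem det_vectorField_mem_jacobianExt {ν : Type*} [Fintype ν] [DecidableEq ν] (f : ν → J)
    (c : ν → ι → HolGerm ι) :
    (of fun j i => vectorField (c i) (f j).1).det ∈ jacobianExt (Fintype.card ν) J := by
  have hmul : (of fun j i => vectorField (c i) (f j).1) =
      (jacobian J).submatrix f id * (of c)ᵀ := by
    ext1 j i
    exact (congrFun₂ (jacobian_mul_transpose J (of c)) (f j) i).symm
  rw [hmul]
  refine det_mul_mem_of_forall_det_submatrix_mem (fun p => ?_) _
  let e := (Fintype.equivFin ν).symm
  rw [← det_submatrix_equiv_self e]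
  exact Ideal.mem_sup_right (Ideal.subset_span ⟨f ∘ e, p ∘ e, rfl⟩)

theorem jacobianExt_ne_top (hJ : J ≤ RingHom.ker (evalHom ι)) {k : ℕ}
    (hk : jacobianRankAtZero J < k) : jacobianExt k J ≠ ⊤ := by
  refine ne_top_of_le_ne_top (RingHom.ker_ne_top (evalHom ι)) (sup_le hJ (Ideal.span_le.2 ?_))
  rintro _ ⟨rows, cols, rfl⟩
  by_contra hdet
  rw [SetLike.mem_coe, RingHom.mem_ker, RingHom.map_det] at hdet
  have hle : (((jacobian J).map evalZero).submatrix rows cols).rank ≤ jacobianRankAtZero J :=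
    rank_submatrix_le _ rows cols
  have heq : (((jacobian J).map evalZero).submatrix rows cols).rank = k :=
    (rank_of_det_ne_zero hdet).trans (Fintype.card_fin k)
  omega

end JacobianExtension

section AdaptedFrame

open Matrix

variable {ι : Type} [Fintype ι] [DecidableEq ι] {κ α : Type*} [Fintype κ] [DecidableEq κ]
  [Fintype α] [DecidableEq α]

/-- A frame of vector fields adapted to an ideal `J` of germs: at the origin the `θ a` annihilate
`J` and the `φ i` are dual to elements `f i` of `J`; the germs `y b`, dual to the `θ a`, witness
that the `θ a` are independent. The `φ i` and `θ a` together span the module of vector fields. -/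
structure IsAdaptedFrame (J : Ideal (HolGerm ι)) (φ : κ → ι → HolGerm ι) (θ : α → ι → HolGerm ι)
    (f : κ → HolGerm ι) (y : α → HolGerm ι) : Prop where
  card : Fintype.card κ + Fintype.card α = Fintype.card ι
  mem : ∀ j, f j ∈ J
  normal : ∀ i j, evalHom ι (vectorField (φ i) (f j)) = if i = j then 1 else 0
  tangent : ∀ a, ∀ g ∈ J, evalHom ι (vectorField (θ a) g) = 0
  dual : ∀ a b, evalHom ι (vectorField (θ a) (y b)) = if a = b then 1 else 0

namespace IsAdaptedFrame

variable {J : Ideal (HolGerm ι)} {φ : κ → ι → HolGerm ι} {θ : α → ι → HolGerm ι}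
  {f : κ → HolGerm ι} {y : α → HolGerm ι}

theorem map_evalHom_normal (h : IsAdaptedFrame J φ θ f y) :
    (of fun j i => vectorField (φ i) (f j)).map (evalHom ι) = 1 := by
  ext j i
  simp only [map_apply, of_apply, h.normal, one_apply, eq_comm]

theorem isUnit_det (h : IsAdaptedFrame J φ θ f y) :
    IsUnit (of fun j i => vectorField (φ i) (f j)).det := by
  apply isUnit_det_of_det_map_evalHom_ne_zero
  rw [h.map_evalHom_normal, det_one]
  exact one_ne_zero

theorem exists_partialDeriv_eq (h : IsAdaptedFrame J φ θ f y) :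
    ∃ (C : Matrix ι κ (HolGerm ι)) (E : Matrix ι α (HolGerm ι)), ∀ i g, partialDeriv i g =
      ∑ k, C i k * vectorField (φ k) g + ∑ a, E i a * vectorField (θ a) g := by
  let B : Matrix (κ ⊕ α) ι (HolGerm ι) := of (Sum.elim φ θ)
  let Y : Matrix ι (κ ⊕ α) (HolGerm ι) := of fun i b => partialDeriv i (Sum.elim f y b)
  have hB (g : HolGerm ι) : (B *ᵥ fun i => partialDeriv i g) =
      fun b => vectorField (Sum.elim φ θ b) g :=
    funext fun b => (vectorField_apply _ g).symm
  have hBY (a b) : (B * Y) a b = vectorField (Sum.elim φ θ a) (Sum.elim f y b) :=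
    congrFun (hB _) a
  have hblocks : (B * Y).map (evalHom ι) =
      fromBlocks 1 (of fun k b => evalHom ι (vectorField (φ k) (y b))) 0 1 := by
    ext (k | a) (j | b)
    · simp [hBY, h.normal, one_apply]
    · simp [hBY]
    · simp [hBY, h.tangent a _ (h.mem j)]
    · simp [hBY, h.dual, one_apply]
  have hdet : IsUnit (B * Y).det := by
    apply isUnit_det_of_det_map_evalHom_ne_zero
    rw [hblocks, det_fromBlocks_zero₂₁, det_one, det_one, one_mul]
    exact one_ne_zero
  have hinv : Y * (B * Y)⁻¹ * B = 1 := by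
    rw [mul_eq_one_comm_of_card_eq _ _ _ (by rw [Fintype.card_sum, h.card]), ← Matrix.mul_assoc,
      mul_nonsing_inv _ hdet]
  refine ⟨(Y * (B * Y)⁻¹).submatrix id Sum.inl, (Y * (B * Y)⁻¹).submatrix id Sum.inr,
    fun i g => ?_⟩
  calc partialDeriv i g = ((Y * (B * Y)⁻¹) *ᵥ (B *ᵥ fun i => partialDeriv i g)) i := by
        rw [mulVec_mulVec, hinv, one_mulVec]
    _ = _ := by rw [hB]; exact Fintype.sum_sum_type _

theorem jacobianRankAtZero_eq (h : IsAdaptedFrame J φ θ f y) :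
    jacobianRankAtZero J = Fintype.card κ := by
  apply le_antisymm
  · obtain ⟨C, E, hC⟩ := h.exists_partialDeriv_eq
    have hfactor : (jacobian J).map evalZero =
        (of fun (g : J) k => evalHom ι (vectorField (φ k) g.1)) * (C.map (evalHom ι))ᵀ := by
      ext g i
      rw [map_apply, jacobian, of_apply, hC i, ← coe_evalHom]
      simp [Matrix.mul_apply, h.tangent _ g.1 g.2, mul_comm]
    rw [jacobianRankAtZero, hfactor]
    exact (rank_mul_le_left _ _).trans (rank_le_card_width _)
  · have hnormal : (((jacobian J).map evalZero) * ((of φ).map (evalHom ι))ᵀ).submatrix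
        (fun j => ⟨f j, h.mem j⟩) id = 1 := by
      rw [← h.map_evalHom_normal]
      ext j i
      simp [Matrix.mul_apply, vectorField_apply, jacobian, ← coe_evalHom, mul_comm]
    calc Fintype.card κ = (1 : Matrix κ κ ℂ).rank := rank_one.symm
      _ ≤ (((jacobian J).map evalZero) * ((of φ).map (evalHom ι))ᵀ).rank := by
        rw [← hnormal]
        exact rank_submatrix_le _ _ _
      _ ≤ jacobianRankAtZero J := rank_mul_le_left _ _

theorem criticalOrder_eq (h : IsAdaptedFrame J φ θ f y) (hJ : J ≤ RingHom.ker (evalHom ι)) :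
    criticalOrder J = Fintype.card κ + 1 := by
  have htop : jacobianExt (Fintype.card κ) J = ⊤ :=
    Ideal.eq_top_of_isUnit_mem _
      (det_vectorField_mem_jacobianExt (fun j => ⟨f j, h.mem j⟩) φ) h.isUnit_det
  have hne : jacobianExt (Fintype.card κ + 1) J ≠ ⊤ :=
    jacobianExt_ne_top hJ (h.jacobianRankAtZero_eq ▸ Nat.lt_succ_self _)
  refine le_antisymm (Nat.sInf_le hne) (le_csInf ⟨_, hne⟩ fun k hk => ?_)
  contrapose! hk
  simpa using top_le_iff.1 (htop ▸ jacobianExt_antitone J (Nat.lt_succ_iff.1 hk))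

theorem criticalIndex_eq (h : IsAdaptedFrame J φ θ f y) (hJ : J ≤ RingHom.ker (evalHom ι)) :
    criticalIndex J = Fintype.card α := by
  rw [criticalIndex, h.criticalOrder_eq hJ, ← h.card]
  omega

theorem jacobianExt_le (h : IsAdaptedFrame J φ θ f y) {K : Ideal (HolGerm ι)} (hJK : J ≤ K)
    (hθ : ∀ a, ∀ g ∈ J, vectorField (θ a) g ∈ K) :
    jacobianExt (Fintype.card κ + 1) J ≤ K := by
  obtain ⟨C, E, hC⟩ := h.exists_partialDeriv_eq
  refine sup_le hJK (Ideal.span_le.2 ?_)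
  rintro _ ⟨rows, cols, rfl⟩
  have hfactor : ((jacobian J).submatrix rows cols).map (Ideal.Quotient.mk K) =
      (of fun a k => Ideal.Quotient.mk K (vectorField (φ k) (rows a).1)) *
        (of fun k b => Ideal.Quotient.mk K (C (cols b) k)) := by
    ext a b
    have hzero (t) : Ideal.Quotient.mk K (vectorField (θ t) (rows a).1) = 0 :=
      Ideal.Quotient.eq_zero_iff_mem.2 (hθ t _ (rows a).2)
    simp [jacobian, hC (cols b), hzero, Matrix.mul_apply, mul_comm]
  rw [SetLike.mem_coe, ← Ideal.Quotient.eq_zero_iff_mem, RingHom.map_det,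
    RingHom.mapMatrix_apply, hfactor]
  exact det_mul_eq_zero_of_card_lt (by simp) _ _

theorem vectorField_mem_jacobianExt (h : IsAdaptedFrame J φ θ f y) {a : α}
    (hθ : ∀ j, vectorField (θ a) (f j) = 0) {g : HolGerm ι} (hg : g ∈ J) :
    vectorField (θ a) g ∈ jacobianExt (Fintype.card κ + 1) J := by
  have hmem := det_vectorField_mem_jacobianExt
    (Sum.elim (fun j => ⟨f j, h.mem j⟩) fun _ : Unit => (⟨g, hg⟩ : J)) (Sum.elim φ fun _ => θ a)
  have hblocks : (of fun j i => vectorField ((Sum.elim φ fun _ : Unit => θ a) i)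
      (Sum.elim (fun j => ⟨f j, h.mem j⟩) (fun _ : Unit => (⟨g, hg⟩ : J)) j).1) =
      fromBlocks (of fun j i => vectorField (φ i) (f j)) 0
        (of fun _ i => vectorField (φ i) g) (of fun _ _ => vectorField (θ a) g) := by
    ext1 (j | _) (i | _)
    · rfl
    · exact hθ j
    · rfl
    · rfl
  rwa [hblocks, det_fromBlocks_zero₁₂, Fintype.card_sum, Fintype.card_unit,
    det_unique (n := Unit), Ideal.unit_mul_mem_iff_mem _ h.isUnit_det] at hmem

theorem criticalExt_eq (h : IsAdaptedFrame J φ θ f y) (hJ : J ≤ RingHom.ker (evalHom ι))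
    (hθ : ∀ a j, vectorField (θ a) (f j) = 0) :
    criticalExt J = J ⊔ Ideal.span {d | ∃ a, ∃ g ∈ J, d = vectorField (θ a) g} := by
  rw [criticalExt, h.criticalOrder_eq hJ]
  apply le_antisymm
  · exact h.jacobianExt_le le_sup_left fun a g hg =>
      Ideal.mem_sup_right (Ideal.subset_span ⟨a, g, hg, rfl⟩)
  · refine sup_le le_sup_left (Ideal.span_le.2 ?_)
    rintro _ ⟨a, g, hg, rfl⟩
    exact h.vectorField_mem_jacobianExt (hθ a) hg

end IsAdaptedFrame

end AdaptedFrame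

open Polynomial

section PolynomialIdeals

variable {R S : Type*} [CommRing R] [CommRing S] {K : Ideal R} {g p : R[X]}

theorem mem_map_C_ker_iff (φ : R →+* S) : p ∈ (RingHom.ker φ).map C ↔ p.map φ = 0 := by
  rw [← ker_mapRingHom, RingHom.mem_ker, coe_mapRingHom]

theorem monic_mul_mem_map_C_iff (hg : g.Monic) : g * p ∈ K.map C ↔ p ∈ K.map C := by
  rw [← K.mk_ker, mem_map_C_ker_iff, mem_map_C_ker_iff, Polynomial.map_mul,
    (hg.map _).mul_right_eq_zero_iff]

theorem modByMonic_mem_map_C (hg : g.Monic) (hp : p ∈ K.map C) : p %ₘ g ∈ K.map C := by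
  rw [← K.mk_ker, mem_map_C_ker_iff] at hp ⊢
  rw [map_modByMonic _ hg, hp, zero_modByMonic]

theorem span_range_coeff_le_iff : Ideal.span (Set.range p.coeff) ≤ K ↔ p ∈ K.map C := by
  rw [Ideal.span_le, Set.range_subset_iff, Ideal.mem_map_C_iff]
  rfl

end PolynomialIdeals

section PolynomialDegrees

variable {R : Type*} [CommRing R]

theorem degree_mul_lt_add {p q : R[X]} {a b : ℕ} (hp : p.degree < a) (hq : q.degree ≤ b) :
    (p * q).degree < (a + b : ℕ) := by
  calc (p * q).degree ≤ p.degree + q.degree := degree_mul_le p q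
    _ ≤ p.degree + b := by gcongr
    _ < a + b := WithBot.add_lt_add_right (WithBot.natCast_ne_bot b) hp
    _ = (a + b : ℕ) := (Nat.cast_add a b).symm

theorem sum_C_coeff_mul_X_pow {p : R[X]} {k : ℕ} (hp : p.degree < k) :
    ∑ i : Fin k, C (p.coeff i) * X ^ (i : ℕ) = p :=
  (sum_fin (fun i a => C a * X ^ i) (fun i => by simp) hp).trans p.sum_C_mul_X_pow_eq

end PolynomialDegrees

/-- The monic polynomial over an arbitrary ring with prescribed lower coefficients; over `ℂ` this
is `monicPoly`. -/
def monicOfCoeffs {R : Type*} [CommRing R] {k : ℕ} (c : Fin k → R) : R[X] :=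
  X ^ k + ∑ i : Fin k, C (c i) * X ^ (i : ℕ)

section MonicOfCoeffs

variable {R S : Type*} [CommRing R] [CommRing S] {k : ℕ} (c : Fin k → R)

theorem monicOfCoeffs_monic : (monicOfCoeffs c).Monic := monic_X_pow_add (degree_sum_fin_lt c)

theorem natDegree_monicOfCoeffs [Nontrivial R] : (monicOfCoeffs c).natDegree = k := by
  rw [monicOfCoeffs, natDegree_add_eq_left_of_degree_lt, natDegree_X_pow]
  rw [degree_X_pow]
  exact degree_sum_fin_lt c

theorem map_monicOfCoeffs (f : R →+* S) :
    (monicOfCoeffs c).map f = monicOfCoeffs fun i => f (c i) := by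
  simp [monicOfCoeffs, Polynomial.map_sum]

theorem monicOfCoeffs_zero : monicOfCoeffs (fun _ : Fin k => (0 : R)) = X ^ k := by
  simp [monicOfCoeffs]

end MonicOfCoeffs

section CoeffDeriv

variable {R : Type*} [CommRing R] (D : Derivation ℤ R R)

/-- The action of a derivation of `R` on the coefficients of polynomials over `R`. -/
def coeffDeriv : Derivation ℤ R[X] R[X] :=
  letI : Differential R := ⟨D⟩
  Differential.mapCoeffs

theorem coeff_coeffDeriv (p : R[X]) (j : ℕ) : (coeffDeriv D p).coeff j = D (p.coeff j) := rfl

theorem degree_coeffDeriv_lt {p : R[X]} {k : ℕ} (h : p.degree < k) :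
    (coeffDeriv D p).degree < k := by
  rw [degree_lt_iff_coeff_zero] at h ⊢
  intro m hm
  rw [coeff_coeffDeriv, h m hm, map_zero]

theorem coeffDeriv_C_mul_X_pow (a : R) (i : ℕ) :
    coeffDeriv D (C a * X ^ i) = C (D a) * X ^ i := by
  ext j
  rw [coeff_coeffDeriv, coeff_C_mul_X_pow, coeff_C_mul_X_pow, apply_ite D, map_zero]

theorem coeffDeriv_X_pow (i : ℕ) : coeffDeriv D (X ^ i) = 0 := by
  simpa using coeffDeriv_C_mul_X_pow D 1 i

theorem coeffDeriv_monicOfCoeffs {k : ℕ} (c : Fin k → R) :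
    coeffDeriv D (monicOfCoeffs c) = ∑ i : Fin k, C (D (c i)) * X ^ (i : ℕ) := by
  simp only [monicOfCoeffs, map_add, map_sum, coeffDeriv_X_pow, coeffDeriv_C_mul_X_pow, zero_add]

theorem coeffDeriv_pow_succ_mul (s : ℕ) (g q : R[X]) :
    coeffDeriv D (g ^ (s + 1) * q) =
      g ^ s * (coeffDeriv D ((s + 1 : ℕ) • g) * q + g * coeffDeriv D q) := by
  rw [map_nsmul]
  simp only [Derivation.leibniz, Derivation.leibniz_pow, smul_eq_mul, nsmul_eq_mul,
    Nat.add_sub_cancel]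
  ring

theorem coeffDeriv_divByMonic_modByMonic {g p u v ρ : R[X]} (hg : g.Monic)
    (hρ : ρ.degree < g.degree) (hu : coeffDeriv D g = u)
    (hp : coeffDeriv D p = ρ + (u * (p /ₘ g) + v * g)) :
    coeffDeriv D (p /ₘ g) = v ∧ coeffDeriv D (p %ₘ g) = ρ := by
  nontriviality R
  have hdeg : (coeffDeriv D (p %ₘ g)).degree < g.degree := by
    rw [degree_eq_natDegree hg.ne_zero]
    apply degree_coeffDeriv_lt
    rw [← degree_eq_natDegree hg.ne_zero]
    exact degree_modByMonic_lt _ hg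
  have heq : coeffDeriv D (p %ₘ g) + g * coeffDeriv D (p /ₘ g) = ρ + g * v := by
    have h := congrArg (coeffDeriv D) (modByMonic_add_div p g)
    rw [hp, map_add, Derivation.leibniz, hu, smul_eq_mul, smul_eq_mul] at h
    linear_combination h
  obtain ⟨hdiv, hmod⟩ := div_modByMonic_unique v ρ hg ⟨rfl, hρ⟩
  obtain ⟨hdiv', hmod'⟩ := div_modByMonic_unique _ _ hg ⟨heq, hdeg⟩
  exact ⟨hdiv'.symm.trans hdiv, hmod'.symm.trans hmod⟩

theorem derivation_mem_of_mem_span {S : Set R} {K : Ideal R} (hSK : Ideal.span S ≤ K)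
    (hD : ∀ x ∈ S, D x ∈ K) {x : R} (hx : x ∈ Ideal.span S) : D x ∈ K := by
  induction hx using Submodule.span_induction with
  | mem x hx => exact hD x hx
  | zero => simp
  | add x y _ _ hx hy => rw [map_add]; exact K.add_mem hx hy
  | smul a x hxS hx =>
    rw [smul_eq_mul, Derivation.leibniz]
    exact K.add_mem (K.mul_mem_left _ hx) (K.mul_mem_right _ (hSK hxS))

end CoeffDeriv

section Digits

variable {R S : Type*} [CommRing R] [CommRing S]

/-- The `s`-th iterated quotient of `f` by `g`. -/
def quot (f g : R[X]) (s : ℕ) : R[X] := (· /ₘ g)^[s] f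

/-- The `s`-th digit of `f` in base `g`: the remainder of the `s`-th iterated quotient. -/
def digit (f g : R[X]) (s : ℕ) : R[X] := quot f g s %ₘ g

/-- The polynomial `g ^ (s + 1) * quot f g s` without its leading monomial, for monic `f` and `g`
with `s * g.natDegree ≤ f.natDegree`. -/
def tail (f g : R[X]) (s : ℕ) : R[X] :=
  g ^ (s + 1) * quot f g s - X ^ (f.natDegree + g.natDegree)

/-- The ideal generated by the coefficients of the first `s` digits of `f` in base `g` and of
`tail f g s`; these are the successive critical extensions of the ideal generated by the
coefficients of `f * g`. -/
def digitIdeal (f g : R[X]) (s : ℕ) : Ideal R :=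
  Ideal.span ((⋃ i < s, Set.range (digit f g i).coeff) ∪ Set.range (tail f g s).coeff)

variable {f g : R[X]} {s : ℕ}

theorem quot_succ : quot f g (s + 1) = quot f g s /ₘ g := Function.iterate_succ_apply' _ _ _

theorem digit_add_mul_quot_succ : digit f g s + g * quot f g (s + 1) = quot f g s := by
  rw [quot_succ]
  exact modByMonic_add_div _ _

theorem digit_modByMonic (hg : g.Monic) : digit f g s %ₘ g = digit f g s := by
  nontriviality R
  exact (modByMonic_eq_self_iff hg).2 (degree_modByMonic_lt _ hg)

theorem mul_quot_modByMonic (hg : g.Monic) (p : R[X]) :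
    (p * quot f g s) %ₘ g = (p * digit f g s) %ₘ g := by
  refine modByMonic_eq_of_dvd_sub hg ⟨p * quot f g (s + 1), ?_⟩
  rw [← digit_add_mul_quot_succ (s := s)]
  ring

theorem natDegree_quot (hg : g.Monic) :
    (quot f g s).natDegree = f.natDegree - s * g.natDegree := by
  induction s with
  | zero => rw [zero_mul, Nat.sub_zero]; rfl
  | succ s ih => rw [quot_succ, natDegree_divByMonic _ hg, ih, Nat.sub_sub, Nat.succ_mul]

theorem map_quot (hg : g.Monic) (φ : R →+* S) :
    (quot f g s).map φ = quot (f.map φ) (g.map φ) s := by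
  induction s with
  | zero => rfl
  | succ s ih => rw [quot_succ, quot_succ, map_divByMonic _ hg, ih]

theorem map_digit (hg : g.Monic) (φ : R →+* S) :
    (digit f g s).map φ = digit (f.map φ) (g.map φ) s := by
  rw [digit, digit, map_modByMonic _ hg, map_quot hg]

theorem map_tail [Nontrivial S] (hf : f.Monic) (hg : g.Monic) (φ : R →+* S) :
    (tail f g s).map φ = tail (f.map φ) (g.map φ) s := by
  simp only [tail, Polynomial.map_sub, Polynomial.map_mul, Polynomial.map_pow, map_X, map_quot hg,
    hf.natDegree_map, hg.natDegree_map]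

theorem quot_X_pow {n r : ℕ} (hs : s * r ≤ n) :
    quot (X ^ n : R[X]) (X ^ r) s = X ^ (n - s * r) := by
  induction s with
  | zero => rw [zero_mul, Nat.sub_zero]; rfl
  | succ s ih =>
    rw [Nat.succ_mul] at hs ⊢
    rw [quot_succ, ih (by omega), show n - s * r = r + (n - (s * r + r)) by omega, pow_add,
      mul_divByMonic_cancel_left _ (monic_X_pow r)]

theorem digit_X_pow {n r : ℕ} (hs : (s + 1) * r ≤ n) : digit (X ^ n : R[X]) (X ^ r) s = 0 := by
  rw [Nat.succ_mul] at hs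
  rw [digit, quot_X_pow (by omega), modByMonic_eq_zero_iff_dvd (monic_X_pow r)]
  exact pow_dvd_pow X (by omega)

theorem tail_X_pow [Nontrivial R] {n r : ℕ} (hs : s * r ≤ n) :
    tail (X ^ n : R[X]) (X ^ r) s = 0 := by
  rw [tail, quot_X_pow hs, natDegree_X_pow, natDegree_X_pow, ← pow_mul, ← pow_add, sub_eq_zero,
    mul_comm, Nat.succ_mul]
  congr 1
  omega

theorem digitIdeal_le_iff {K : Ideal R} :
    digitIdeal f g s ≤ K ↔ (∀ i < s, digit f g i ∈ K.map C) ∧ tail f g s ∈ K.map C := by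
  simp only [digitIdeal, Ideal.span_union, Ideal.span_iUnion, sup_le_iff, iSup_le_iff,
    span_range_coeff_le_iff]

theorem coeff_digit_mem_digitIdeal {i : ℕ} (hi : i < s) (l : ℕ) :
    (digit f g i).coeff l ∈ digitIdeal f g s :=
  Ideal.mem_map_C_iff.1 ((digitIdeal_le_iff.1 le_rfl).1 i hi) l

theorem coeff_tail_mem_digitIdeal (l : ℕ) : (tail f g s).coeff l ∈ digitIdeal f g s :=
  Ideal.mem_map_C_iff.1 (digitIdeal_le_iff.1 le_rfl).2 l

theorem digitIdeal_sup_span_coeff_digit :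
    digitIdeal f g s ⊔ Ideal.span (Set.range (digit f g s).coeff) = digitIdeal f g (s + 1) := by
  have htail : tail f g s = g ^ (s + 1) * digit f g s + tail f g (s + 1) := by
    rw [tail, tail, ← digit_add_mul_quot_succ (s := s)]
    ring
  refine eq_of_forall_ge_iff fun K => ?_
  rw [sup_le_iff, digitIdeal_le_iff, digitIdeal_le_iff, span_range_coeff_le_iff,
    Nat.forall_lt_succ_right, and_right_comm, htail]
  exact and_congr_right fun h => (K.map C).add_mem_iff_right ((K.map C).mul_mem_left _ h.2)

theorem digitIdeal_le_ker [Nontrivial S] (hf : f.Monic) (hg : g.Monic) (φ : R →+* S) {n r : ℕ}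
    (hfφ : f.map φ = X ^ n) (hgφ : g.map φ = X ^ r) (hs : s * r ≤ n) :
    digitIdeal f g s ≤ RingHom.ker φ := by
  rw [digitIdeal_le_iff]
  simp only [mem_map_C_ker_iff, map_digit hg, map_tail hf hg, hfφ, hgφ]
  exact ⟨fun i hi => digit_X_pow ((Nat.mul_le_mul_right r hi).trans hs), tail_X_pow hs⟩

theorem derivation_mem_of_mem_digitIdeal (D : Derivation ℤ R R) {K : Ideal R}
    (hK : digitIdeal f g s ≤ K) (hdigit : ∀ i < s, coeffDeriv D (digit f g i) ∈ K.map C)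
    (htail : coeffDeriv D (tail f g s) ∈ K.map C) {x : R} (hx : x ∈ digitIdeal f g s) :
    D x ∈ K := by
  refine derivation_mem_of_mem_span D hK ?_ hx
  simp only [Set.mem_union, Set.mem_iUnion, Set.mem_range]
  rintro _ (⟨i, hi, l, rfl⟩ | ⟨l, rfl⟩)
  · exact Ideal.mem_map_C_iff.1 (hdigit i hi) l
  · exact Ideal.mem_map_C_iff.1 htail l

theorem coeffDeriv_tail (D : Derivation ℤ R R) :
    coeffDeriv D (tail f g s) = g ^ s *
      (coeffDeriv D ((s + 1 : ℕ) • g) * quot f g s + g * coeffDeriv D (quot f g s)) := by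
  rw [tail, map_sub, coeffDeriv_X_pow, sub_zero, coeffDeriv_pow_succ_mul]

end Digits

section GenericPolynomials

variable (n r : ℕ)

/-- The polynomial `f` whose lower coefficients are the coordinates `a_i`. -/
def genericF : (HolGerm (Fin n ⊕ Fin r))[X] := monicOfCoeffs fun i => coordGerm (Sum.inl i)

/-- The polynomial `g` whose lower coefficients are the coordinates `b_j`. -/
def genericG : (HolGerm (Fin n ⊕ Fin r))[X] := monicOfCoeffs fun j => coordGerm (Sum.inr j)

local notation "𝐟" => genericF n r
local notation "𝐠" => genericG n r

theorem monic_genericF : 𝐟.Monic := monicOfCoeffs_monic _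

theorem monic_genericG : 𝐠.Monic := monicOfCoeffs_monic _

theorem natDegree_genericF : 𝐟.natDegree = n := natDegree_monicOfCoeffs _

theorem natDegree_genericG : 𝐠.natDegree = r := natDegree_monicOfCoeffs _

theorem degree_genericG : 𝐠.degree = r := by
  rw [degree_eq_natDegree (monic_genericG n r).ne_zero, natDegree_genericG]

theorem map_genericF : 𝐟.map (evalHom _) = X ^ n :=
  (map_monicOfCoeffs _ _).trans monicOfCoeffs_zero

theorem map_genericG : 𝐠.map (evalHom _) = X ^ r :=
  (map_monicOfCoeffs _ _).trans monicOfCoeffs_zero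

theorem coeff_genericF_mul_genericG (j : Fin (n + r)) :
    (𝐟 * 𝐠).coeff j = HolGerm.mk (fun p => mulMap n r p j) (analyticAt_mulMap n r j) := by
  let F : ((Fin n ⊕ Fin r → ℂ) → ℂ)[X] := monicOfCoeffs fun i p => p (Sum.inl i)
  let G : ((Fin n ⊕ Fin r → ℂ) → ℂ)[X] := monicOfCoeffs fun i p => p (Sum.inr i)
  have hvalue : (F * G).coeff j = fun p => mulMap n r p j := by
    funext p
    change Pi.evalRingHom (fun _ => ℂ) p ((F * G).coeff j) = _
    rw [← coeff_map, Polynomial.map_mul, map_monicOfCoeffs, map_monicOfCoeffs]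
    rfl
  have hgerm : (𝐟 * 𝐠).map (HolGerm _).subtype = (F * G).map (Germ.coeRingHom (𝓝 0)) := by
    simp only [Polynomial.map_mul, genericF, genericG, F, G, map_monicOfCoeffs]
    rfl
  apply Subtype.ext
  calc (HolGerm _).subtype ((𝐟 * 𝐠).coeff j)
      = ((𝐟 * 𝐠).map (HolGerm _).subtype).coeff j := (coeff_map _ _).symm
    _ = Germ.coeRingHom (𝓝 0) ((F * G).coeff j) := by rw [hgerm, coeff_map]
    _ = _ := by rw [hvalue]; rfl

theorem mulIdeal_eq_digitIdeal : mulIdeal n r = digitIdeal 𝐟 𝐠 0 := by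
  have hmonic := (monic_genericF n r).mul (monic_genericG n r)
  have hdeg : (𝐟 * 𝐠).natDegree = 𝐟.natDegree + 𝐠.natDegree :=
    (monic_genericF n r).natDegree_mul (monic_genericG n r)
  have htail : tail 𝐟 𝐠 0 = ∑ l ∈ Finset.range (n + r), C ((𝐟 * 𝐠).coeff l) * X ^ l := by
    calc tail 𝐟 𝐠 0 = 𝐟 * 𝐠 - X ^ (𝐟 * 𝐠).natDegree := by
          rw [tail, zero_add, pow_one, mul_comm, hdeg]
          rfl
      _ = _ := by
          nth_rw 1 [hmonic.as_sum]
          rw [add_sub_cancel_left, hdeg, natDegree_genericF, natDegree_genericG]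
  have hcoeff (l : ℕ) : (tail 𝐟 𝐠 0).coeff l = if l < n + r then (𝐟 * 𝐠).coeff l else 0 := by
    simp [htail, coeff_X_pow]
  apply le_antisymm
  · refine Ideal.span_le.2 ?_
    rintro _ ⟨j, rfl⟩
    have hj := coeff_tail_mem_digitIdeal (f := 𝐟) (g := 𝐠) (s := 0) j
    rwa [hcoeff, if_pos j.2, coeff_genericF_mul_genericG] at hj
  · refine digitIdeal_le_iff.2 ⟨by simp, Ideal.mem_map_C_iff.2 fun l => ?_⟩
    rw [hcoeff]
    split_ifs with hl
    · exact Ideal.subset_span ⟨⟨l, hl⟩, (coeff_genericF_mul_genericG n r ⟨l, hl⟩).symm⟩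
    · exact Ideal.zero_mem _

variable {n r} {s : ℕ}

theorem degree_quot_le : (quot 𝐟 𝐠 s).degree ≤ (n - s * r : ℕ) := by
  refine degree_le_natDegree.trans_eq ?_
  rw [natDegree_quot (monic_genericG n r), natDegree_genericF, natDegree_genericG]

theorem exists_vectorField (hs : s * r ≤ n) {u v : (HolGerm (Fin n ⊕ Fin r))[X]}
    {ρ : ℕ → (HolGerm (Fin n ⊕ Fin r))[X]} (hu : u.degree < r) (hv : v.degree < (n - s * r : ℕ))
    (hρ : ∀ i, (ρ i).degree < r) :
    ∃ c, coeffDeriv (vectorField c) 𝐠 = u ∧ coeffDeriv (vectorField c) (quot 𝐟 𝐠 s) = v ∧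
      ∀ i < s, coeffDeriv (vectorField c) (digit 𝐟 𝐠 i) = ρ i := by
  induction s generalizing v with
  | zero =>
    rw [zero_mul, Nat.sub_zero] at hv
    refine ⟨Sum.elim (fun i => v.coeff i) (fun j => u.coeff j), ?_, ?_, by simp⟩
    · rw [genericG, coeffDeriv_monicOfCoeffs]
      simp only [vectorField_coordGerm, Sum.elim_inr]
      exact sum_C_coeff_mul_X_pow hu
    · rw [quot, Function.iterate_zero_apply, genericF, coeffDeriv_monicOfCoeffs]
      simp only [vectorField_coordGerm, Sum.elim_inl]
      exact sum_C_coeff_mul_X_pow hv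
  | succ s ih =>
    rw [Nat.succ_mul] at hs hv
    have hdeg : (ρ s + (u * quot 𝐟 𝐠 (s + 1) + v * 𝐠)).degree < (n - s * r : ℕ) := by
      rw [show n - s * r = r + (n - (s * r + r)) by omega]
      have huq : (u * quot 𝐟 𝐠 (s + 1)).degree < (r + (n - (s * r + r)) : ℕ) :=
        degree_mul_lt_add hu (Nat.succ_mul s r ▸ degree_quot_le)
      have hvg : (v * 𝐠).degree < (r + (n - (s * r + r)) : ℕ) :=
        (degree_mul_lt_add hv (degree_genericG n r).le).trans_eq (by rw [add_comm])
      have hρs : (ρ s).degree < (r + (n - (s * r + r)) : ℕ) :=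
        (hρ s).trans_le (Nat.cast_le.2 (Nat.le_add_right _ _))
      rw [← mem_degreeLT] at hρs huq hvg ⊢
      exact add_mem hρs (add_mem huq hvg)
    obtain ⟨c, hg, hq, hd⟩ := ih (by omega) hdeg
    rw [quot_succ] at hq
    obtain ⟨hv', hρ'⟩ := coeffDeriv_divByMonic_modByMonic _ (monic_genericG n r)
      (by rw [degree_genericG]; exact hρ s) hg hq
    refine ⟨c, hg, by rwa [quot_succ], Nat.forall_lt_succ_right.2 ⟨hd, hρ'⟩⟩

theorem exists_vectorField_tail (hs : s * r ≤ n) {u v : (HolGerm (Fin n ⊕ Fin r))[X]}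
    {ρ : ℕ → (HolGerm (Fin n ⊕ Fin r))[X]} (hu : u.degree < r) (hv : v.degree < (n - s * r : ℕ))
    (hρ : ∀ i, (ρ i).degree < r) :
    ∃ c, coeffDeriv (vectorField c) ((s + 1 : ℕ) • 𝐠) = u ∧
      coeffDeriv (vectorField c) (tail 𝐟 𝐠 s) = 𝐠 ^ s * (u * quot 𝐟 𝐠 s + 𝐠 * v) ∧
      ∀ i < s, coeffDeriv (vectorField c) (digit 𝐟 𝐠 i) = ρ i := by
  obtain ⟨w, hw⟩ := (isUnit_natCast_succ (ι := Fin n ⊕ Fin r) s).exists_right_inv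
  obtain ⟨c, hg, hq, hd⟩ := exists_vectorField hs (u := w • u)
    ((degree_smul_le w u).trans_lt hu) hv hρ
  have hu' : coeffDeriv (vectorField c) ((s + 1 : ℕ) • 𝐠) = u := by
    rw [map_nsmul, hg, ← Nat.cast_smul_eq_nsmul (HolGerm (Fin n ⊕ Fin r)), smul_smul, hw, one_smul]
  exact ⟨c, hu', by rw [coeffDeriv_tail, hu', hq], hd⟩

theorem map_quot_generic (hs : s * r ≤ n) : (quot 𝐟 𝐠 s).map (evalHom _) = X ^ (n - s * r) := by
  rw [map_quot (monic_genericG n r), map_genericF, map_genericG, quot_X_pow hs]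

theorem digitIdeal_le_ker_evalHom (hs : s * r ≤ n) :
    digitIdeal 𝐟 𝐠 s ≤ RingHom.ker (evalHom _) :=
  digitIdeal_le_ker (monic_genericF n r) (monic_genericG n r) _ (map_genericF n r)
    (map_genericG n r) hs

variable (n r s) in
/-- Elements of `digitIdeal 𝐟 𝐠 s` whose differentials at the origin form a basis of the space of
differentials of all its elements: the coefficients of the digits, and the coefficients of the tail
that do not vanish to second order. -/
def definingGerm : (Fin s × Fin r) ⊕ Fin (max r (n - s * r)) → HolGerm (Fin n ⊕ Fin r) :=
  Sum.elim (fun i => (digit 𝐟 𝐠 i.1).coeff i.2)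
    fun l => (tail 𝐟 𝐠 s).coeff (s * r + (min r (n - s * r) + l))

theorem definingGerm_mem (j) : definingGerm n r s j ∈ digitIdeal 𝐟 𝐠 s := by
  rcases j with i | l
  exacts [coeff_digit_mem_digitIdeal i.1.2 _, coeff_tail_mem_digitIdeal _]

theorem exists_map_eq_X_pow (hs : s * r ≤ n) (l : Fin (max r (n - s * r))) :
    ∃ u v : (HolGerm (Fin n ⊕ Fin r))[X], u.degree < r ∧ v.degree < (n - s * r : ℕ) ∧
      (u * quot 𝐟 𝐠 s + 𝐠 * v).map (evalHom _) = X ^ (min r (n - s * r) + l) := by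
  rcases le_or_gt r (n - s * r) with h | h
  · refine ⟨0, X ^ (l : ℕ), by simp, ?_, ?_⟩
    · rw [degree_X_pow, Nat.cast_lt]
      omega
    · simp [map_genericG, min_eq_left h, pow_add]
  · refine ⟨X ^ (l : ℕ), 0, ?_, by simp, ?_⟩
    · rw [degree_X_pow, Nat.cast_lt]
      omega
    · rw [mul_zero, add_zero, Polynomial.map_mul, map_quot_generic hs, min_eq_right h.le, add_comm,
        pow_add, Polynomial.map_pow, map_X]

theorem exists_normalField (hs : s * r ≤ n) (i) :
    ∃ c, ∀ j, evalHom _ (vectorField c (definingGerm n r s j)) = if i = j then 1 else 0 := by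
  rcases i with ⟨i, k⟩ | l
  · obtain ⟨c, -, htail, hdigit⟩ := exists_vectorField_tail hs (u := 0) (v := 0)
      (ρ := fun i' => if i = i' then X ^ (k : ℕ) else 0) (by simp) (by simp) (fun i' => by
        split_ifs
        · rw [degree_X_pow, Nat.cast_lt]
          exact k.2
        · simp)
    refine ⟨c, ?_⟩
    rintro (⟨i', k'⟩ | l)
    · simp only [definingGerm, Sum.elim_inl, ← coeff_coeffDeriv, hdigit i' i'.2]
      by_cases hi : i = i'
      · simp [hi, coeff_X_pow, Fin.val_inj, eq_comm]
      · simp [hi, Fin.val_inj]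
    · simp [definingGerm, ← coeff_coeffDeriv, htail]
  · obtain ⟨u, v, hu, hv, huv⟩ := exists_map_eq_X_pow hs l
    obtain ⟨c, -, htail, hdigit⟩ := exists_vectorField_tail hs (ρ := 0) hu hv (by simp)
    refine ⟨c, ?_⟩
    rintro (⟨i', k'⟩ | l')
    · simp [definingGerm, ← coeff_coeffDeriv, hdigit i' i'.2]
    · have hmap : (coeffDeriv (vectorField c) (tail 𝐟 𝐠 s)).map (evalHom _) =
          X ^ (s * r + (min r (n - s * r) + l)) := by
        rw [htail, Polynomial.map_mul, huv, Polynomial.map_pow, map_genericG, ← pow_mul, ← pow_add,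
          mul_comm r]
      rw [definingGerm, Sum.elim_inr, ← coeff_coeffDeriv, ← coeff_map, hmap, coeff_X_pow]
      simp [Fin.val_inj, eq_comm]

theorem exists_tangentField (hs : s * r ≤ n) (a : Fin (min r (n - s * r))) :
    ∃ c, coeffDeriv (vectorField c) ((s + 1 : ℕ) • 𝐠) = X ^ (r - min r (n - s * r) + a) ∧
      coeffDeriv (vectorField c) (tail 𝐟 𝐠 s) =
        𝐠 ^ s * ((X ^ (r - min r (n - s * r) + a) * quot 𝐟 𝐠 s) %ₘ 𝐠) ∧
      ∀ i < s, coeffDeriv (vectorField c) (digit 𝐟 𝐠 i) = 0 := by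
  have ha := a.2
  set b := r - min r (n - s * r) + a
  have hu : (X ^ b : (HolGerm (Fin n ⊕ Fin r))[X]).degree < r := by
    rw [degree_X_pow, Nat.cast_lt]
    omega
  have hv : (-((X ^ b * quot 𝐟 𝐠 s) /ₘ 𝐠)).degree < (n - s * r : ℕ) := by
    have hle : ((X ^ b * quot 𝐟 𝐠 s) /ₘ 𝐠).natDegree ≤ b + (n - s * r) - r := by
      rw [natDegree_divByMonic _ (monic_genericG n r), natDegree_genericG]
      refine Nat.sub_le_sub_right (natDegree_mul_le.trans ?_) r
      exact add_le_add (natDegree_X_pow_le b) (natDegree_le_iff_degree_le.2 degree_quot_le)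
    rw [degree_neg]
    refine degree_le_natDegree.trans_lt (Nat.cast_lt.2 ?_)
    omega
  -- Moving the quotient as in `hv` cancels the part of `x ^ b * quot 𝐟 𝐠 s` divisible by `𝐠`.
  obtain ⟨c, hg, htail, hdigit⟩ := exists_vectorField_tail hs (ρ := 0) hu hv (by simp)
  refine ⟨c, hg, ?_, hdigit⟩
  rw [htail, modByMonic_eq_sub_mul_div]
  ring

theorem exists_isAdaptedFrame (hs : s * r ≤ n) :
    ∃ φ, ∃ θ : Fin (min r (n - s * r)) → _, ∃ y,
      IsAdaptedFrame (digitIdeal 𝐟 𝐠 s) φ θ (definingGerm n r s) y ∧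
      ∀ a, coeffDeriv (vectorField (θ a)) (tail 𝐟 𝐠 s) =
          𝐠 ^ s * ((X ^ (r - min r (n - s * r) + a) * quot 𝐟 𝐠 s) %ₘ 𝐠) ∧
        ∀ i < s, coeffDeriv (vectorField (θ a)) (digit 𝐟 𝐠 i) = 0 := by
  choose φ hφ using exists_normalField (n := n) (r := r) (s := s) hs
  choose θ hθg hθtail hθdigit using exists_tangentField (n := n) (r := r) (s := s) hs
  refine ⟨φ, θ, fun b => ((s + 1 : ℕ) • 𝐠).coeff (r - min r (n - s * r) + b),
    { card := ?_, mem := definingGerm_mem, normal := hφ, tangent := ?_, dual := ?_ },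
    fun a => ⟨hθtail a, hθdigit a⟩⟩
  · simp only [Fintype.card_sum, Fintype.card_prod, Fintype.card_fin]
    omega
  · intro a g hg
    rw [← RingHom.mem_ker]
    refine derivation_mem_of_mem_digitIdeal _ (digitIdeal_le_ker_evalHom hs)
      (fun i hi => ?_) ?_ hg
    · rw [hθdigit a i hi]
      exact Ideal.zero_mem _
    · rw [hθtail, mem_map_C_ker_iff, Polynomial.map_mul, map_modByMonic _ (monic_genericG n r),
        Polynomial.map_mul, map_quot_generic hs, map_genericG, Polynomial.map_pow (p := X), map_X,
        ← pow_add,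
        (modByMonic_eq_zero_iff_dvd (monic_X_pow r)).2 (pow_dvd_pow X (by omega)), mul_zero]
  · intro a b
    rw [← coeff_coeffDeriv, hθg, coeff_X_pow]
    simp [Fin.val_inj, eq_comm, apply_ite]

theorem criticalIndex_digitIdeal (hs : s * r ≤ n) :
    criticalIndex (digitIdeal 𝐟 𝐠 s) = min r (n - s * r) := by
  obtain ⟨φ, θ, y, h, -⟩ := exists_isAdaptedFrame hs
  rw [h.criticalIndex_eq (digitIdeal_le_ker_evalHom hs), Fintype.card_fin]

theorem jacobianRankAtZero_digitIdeal (hs : s * r ≤ n) :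
    jacobianRankAtZero (digitIdeal 𝐟 𝐠 s) = n + r - min r (n - s * r) := by
  obtain ⟨φ, θ, y, h, -⟩ := exists_isAdaptedFrame hs
  rw [h.jacobianRankAtZero_eq]
  simp only [Fintype.card_sum, Fintype.card_prod, Fintype.card_fin]
  omega

theorem criticalExt_digitIdeal (hr : 0 < r) (hs : (s + 1) * r ≤ n) :
    criticalExt (digitIdeal 𝐟 𝐠 s) = digitIdeal 𝐟 𝐠 (s + 1) := by
  rw [Nat.succ_mul] at hs
  obtain ⟨φ, θ, y, h, hθ⟩ := exists_isAdaptedFrame (show s * r ≤ n by omega)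
  have hmin : r - min r (n - s * r) = 0 := by omega
  simp only [hmin, zero_add, mul_quot_modByMonic (monic_genericG n r)] at hθ
  rw [h.criticalExt_eq (digitIdeal_le_ker_evalHom (by omega)), ← digitIdeal_sup_span_coeff_digit]
  · apply le_antisymm
    · refine sup_le le_sup_left (Ideal.span_le.2 ?_)
      rintro _ ⟨a, x, hx, rfl⟩
      refine derivation_mem_of_mem_digitIdeal _ le_sup_left (fun i hi => ?_) ?_ hx
      · rw [(hθ a).2 i hi]
        exact Ideal.zero_mem _
      · rw [(hθ a).1]
        exact Ideal.mul_mem_left _ _ (modByMonic_mem_map_C (monic_genericG n r)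
          (Ideal.mul_mem_left _ _ (span_range_coeff_le_iff.1 le_sup_right)))
    · refine sup_le le_sup_left (span_range_coeff_le_iff.2 ?_)
      have hθ₀ := (hθ ⟨0, by omega⟩).1
      rw [pow_zero, one_mul, digit_modByMonic (monic_genericG n r)] at hθ₀
      rw [← monic_mul_mem_map_C_iff ((monic_genericG n r).pow s), ← hθ₀, Ideal.mem_map_C_iff]
      exact fun l =>
        Ideal.mem_sup_right (Ideal.subset_span ⟨_, _, coeff_tail_mem_digitIdeal l, rfl⟩)
  · rintro a (i | l)
    · simp [definingGerm, ← coeff_coeffDeriv, (hθ a).2 i.1 i.1.2]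
    · rw [definingGerm, Sum.elim_inr, ← coeff_coeffDeriv, (hθ a).1]
      have hle : r + s * r ≤ s * r + (min r (n - s * r) + l) := by omega
      refine coeff_eq_zero_of_degree_lt (lt_of_lt_of_le ?_ (Nat.cast_le.2 hle))
      rw [mul_comm]
      refine degree_mul_lt_add (q := 𝐠 ^ s) ?_ ?_
      · rw [← degree_genericG n r]
        exact degree_modByMonic_lt _ (monic_genericG n r)
      · exact (degree_pow_le _ s).trans_eq (by simp [degree_genericG])

theorem iterate_criticalExt_mulIdeal (hr : 0 < r) (hs : s * r ≤ n) :
    criticalExt^[s] (mulIdeal n r) = digitIdeal 𝐟 𝐠 s := by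
  induction s with
  | zero => exact mulIdeal_eq_digitIdeal n r
  | succ s ih =>
    rw [Function.iterate_succ_apply', ih ((Nat.mul_le_mul_right r s.le_succ).trans hs),
      criticalExt_digitIdeal hr hs]

end GenericPolynomials

end ThomBoardman

end

open ThomBoardman in
theorem proposition3p8_general (n r s : ℕ) (hr : 0 < r) (hs : s * r ≤ n) :
    TB (mulIdeal n r) s = min r (n - s * r) ∧
    jacobianRankAtZero (criticalExt^[s] (mulIdeal n r)) = n + r - min r (n - s * r) := by
  rw [TB, iterate_criticalExt_mulIdeal hr hs]
  exact ⟨criticalIndex_digitIdeal hs, jacobianRankAtZero_digitIdeal hs⟩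

theorem proposition3p8 (n r q₁ r₁ : ℕ) (hr : 0 < r) (hrn : r ≤ n)
    (hdiv : n = q₁ * r + r₁) (hr₁ : r₁ < r) :
    ThomBoardman.TB (ThomBoardman.mulIdeal n r) q₁ = r₁ ∧
    ThomBoardman.jacobianRankAtZero
      (ThomBoardman.criticalExt^[q₁] (ThomBoardman.mulIdeal n r)) = n + r - r₁ := by
  have hmin : min r (n - q₁ * r) = r₁ := by omega
  simpa only [hmin] using proposition3p8_general n r q₁ hr (by omega)
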